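/- Let $M$ be a smooth manifold (Hausdorff, second countable, without boundary) of dimension $m$, let $U,V\subset M$ be open, and let $q_1>0$, $q_2\ge 0$ be integers. Let $\mathcal F_U$ be a smooth regular foliation of codimension $q_1+q_2$ on $U$ and $\mathcal F_V$ a smooth regular foliation of codimension $q_2$ on $V$, such that $\mathcal F_{U|U\cap V}\subset\mathcal F_{V|U\cap V}$, i.e. every open subset (in the leaf topology) of a leaf of $\mathcal F_V$ that is contained in $U\cap V$ is a union of open subsets of leaves of $\mathcal F_U$. Say that a regular foliation $\mathcal F$ of codimension $q$ on an open set $W\subset M$ is given by the vanishing of $\omega\in\Omega^q(W)$ if $\omega$ has no zeros and every point of $W$ has an open neighbourhood on which $\omega=\alpha_1\wedge\cdots\wedge\alpha_q$ with smooth one-forms $\alpha_1,\dots,\alpha_q$ which at each point span the space of covectors vanishing on the tangent space of the leaf (for $q=0$: $\omega$ is a smooth function without zeros). Suppose that $\mathcal F_U$ and $\mathcal F_V$ are given by the vanishing of $\omega_1\in\Omega^{q_1+q_2}(U)$ and $\omega_2\in\Omega^{q_2}(V)$ respectively. Then there is a smooth form $\theta\in\Omega^{q_1}(U\cap V)$ such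 that $$\omega_1|_{U\cap V}=\omega_2|_{U\cap V}\wedge\theta .$$ -/

import Mathlib

open scoped Manifold ContDiff Topology

noncomputable section

namespace Fol

section Linear

variable {E : Type*} [AddCommGroup E] [Module ℝ E]

/-- The exterior product of two real alternating forms, in the convention
`(a ∧ b)(v₁, …, v_{k+l}) = ∑ sign σ • a(v_{σ 1}, …, v_{σ k}) * b(v_{σ (k+1)}, …, v_{σ (k+l)})`,
the sum being over the `(k, l)`-shuffles `σ`. -/
def wedge {k l : ℕ} (a : E [⋀^Fin k]→ₗ[ℝ] ℝ) (b : E [⋀^Fin l]→ₗ[ℝ] ℝ) :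
    E [⋀^Fin (k + l)]→ₗ[ℝ] ℝ :=
  ((LinearMap.mul' ℝ ℝ).compAlternatingMap (a.domCoprod b)).domDomCongr finSumFinEquiv

/-- The exterior product `a₁ ∧ ⋯ ∧ a_q` of `q` covectors: `(v₁, …, v_q) ↦ det (aᵢ(vⱼ))`. -/
def wedgeCovectors {q : ℕ} (a : Fin q → Module.Dual ℝ E) : E [⋀^Fin q]→ₗ[ℝ] ℝ :=
  Matrix.detRowAlternating.compLinearMap (LinearMap.pi a)

end Linear

variable {m : ℕ} {M : Type*} [TopologicalSpace M]
  [ChartedSpace (EuclideanSpace ℝ (Fin m)) M] [IsManifold (𝓡 m) ∞ M]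

/-- A vector field `X` is smooth on the set `O`. -/
def SmoothVectorFieldOn (O : Set M) (X : ∀ x : M, TangentSpace (𝓡 m) x) : Prop :=
  ContMDiffOn (𝓡 m) ((𝓡 m).prod 𝓘(ℝ, EuclideanSpace ℝ (Fin m))) ∞
    (fun x => (⟨x, X x⟩ : TangentBundle (𝓡 m) M)) O

/-- `η` is a smooth `k`-form on the open set `U`: for all vector fields `X₁, …, X_k` that are
smooth on an open subset `O` of `U`, the function `η(X₁, …, X_k)` is smooth on `O`.
Only the values of `η` on `U` matter. -/
def SmoothFormOn (U : TopologicalSpace.Opens M) {k : ℕ}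
    (η : ∀ x : M, TangentSpace (𝓡 m) x [⋀^Fin k]→ₗ[ℝ] ℝ) : Prop :=
  ∀ O : TopologicalSpace.Opens M, O ≤ U →
    ∀ X : Fin k → ∀ x : M, TangentSpace (𝓡 m) x,
      (∀ i, SmoothVectorFieldOn (O : Set M) (X i)) →
        ContMDiffOn (𝓡 m) 𝓘(ℝ, ℝ) ∞ (fun x => η x (fun i => X i x)) (O : Set M)

/-- `a` is a smooth one-form on `U`, seen as a field of covectors. -/
def SmoothOneFormOn (U : TopologicalSpace.Opens M)
    (a : ∀ x : M, Module.Dual ℝ (TangentSpace (𝓡 m) x)) : Prop :=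
  SmoothFormOn U (k := 1) (fun x => AlternatingMap.ofSubsingleton ℝ _ _ (0 : Fin 1) (a x))

/-- The points `x` and `y` have the same last `q` coordinates in the chart `φ`; for `x`, `y` in
the domain of a foliated chart this says that they lie on the same slice of that chart. -/
def SameSlice (q : ℕ) (φ : OpenPartialHomeomorph M (EuclideanSpace ℝ (Fin m))) (x y : M) : Prop :=
  ∀ i : Fin m, m ≤ (i : ℕ) + q → φ x i = φ y i

variable (m) in
/-- A smooth regular foliation of codimension `q` on the open subset `U` of the `m`-dimensional
manifold `M`, given by a foliated atlas: smooth charts of `M` whose domains cover `U`, such that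
the changes of charts locally preserve the slices on which the last `q` coordinates are constant
(that is, they locally have the form `(x, y) ↦ (f(x, y), g(y))` with `y` in `ℝ^q`). -/
structure RegularFoliation (U : TopologicalSpace.Opens M) (q : ℕ) where
  codim_le : q ≤ m
  charts : Set (OpenPartialHomeomorph M (EuclideanSpace ℝ (Fin m)))
  smooth : charts ⊆ IsManifold.maximalAtlas (𝓡 m) ∞ M
  source_subset : ∀ φ ∈ charts, φ.source ⊆ U
  covers : ∀ x ∈ U, ∃ φ ∈ charts, x ∈ φ.source
  compatible : ∀ φ ∈ charts, ∀ ψ ∈ charts, ∀ x ∈ φ.source ∩ ψ.source,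
    ∃ O : Set M, IsOpen O ∧ x ∈ O ∧ O ⊆ φ.source ∩ ψ.source ∧
      ∀ y ∈ O, ∀ z ∈ O, SameSlice q φ y z → SameSlice q ψ y z

namespace RegularFoliation

variable {U V : TopologicalSpace.Opens M} {q q' : ℕ}

/-- The space of vectors at `x` that are tangent to the leaf through `x`: the last `q` components
vanish in the foliated charts around `x` (equivalently, by compatibility, in one of them). -/
def tangentSpace (F : RegularFoliation m U q) (x : M) :
    Submodule ℝ (TangentSpace (𝓡 m) x) where
  carrier := {v | ∀ φ ∈ F.charts, x ∈ φ.source → ∀ i : Fin m, m ≤ (i : ℕ) + q →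
    (show EuclideanSpace ℝ (Fin m) from
      mfderiv (𝓡 m) 𝓘(ℝ, EuclideanSpace ℝ (Fin m)) φ x v) i = 0}
  zero_mem' := by
    intro φ _ _ i _
    rw [map_zero]
    rfl
  add_mem' := by
    intro v w hv hw φ hφ hx i hi
    have h1 := hv φ hφ hx i hi
    have h2 := hw φ hφ hx i hi
    rw [map_add]
    exact (congrArg₂ (· + ·) h1 h2).trans (add_zero 0)
  smul_mem' := by
    intro c v hv φ hφ hx i hi
    have h1 := hv φ hφ hx i hi
    rw [map_smul]
    exact (congrArg (c * ·) h1).trans (mul_zero c)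

/-- `P` is open for the leaf topology of `F`, the topology on `U` whose connected components are
the leaves; in other words `P` is a union of open subsets of leaves of `F`: around each of its
points, `P` contains a neighbourhood of that point in a slice of a foliated chart. -/
def IsLeafOpen (F : RegularFoliation m U q) (P : Set M) : Prop :=
  P ⊆ U ∧ ∀ x ∈ P, ∃ φ ∈ F.charts, x ∈ φ.source ∧
    ∃ O : Set M, IsOpen O ∧ x ∈ O ∧ ∀ y ∈ O ∩ φ.source, SameSlice q φ x y → y ∈ P

/-- `F ⊂ G` on `U ∩ V`: every open subset of a leaf of `G` that is contained in `U ∩ V` is a union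
of open subsets of leaves of `F`. -/
def NestedIn (F : RegularFoliation m U q) (G : RegularFoliation m V q') : Prop :=
  ∀ P : Set M, P ⊆ (U : Set M) ∩ V → G.IsLeafOpen P → F.IsLeafOpen P

/-- The foliation `F` of codimension `q` is given by `η = 0`: the form `η` is a smooth `q`-form on
`U` without zeros, it has rank `q`, and its local factors generate the one-forms that vanish on
the leaves. The function `h` is only there for `q = 0`, where `η` is a function without zeros;
for `q > 0` it can be absorbed in a factor. -/
structure DefinedBy (F : RegularFoliation m U q)
    (η : ∀ x : M, TangentSpace (𝓡 m) x [⋀^Fin q]→ₗ[ℝ] ℝ) : Prop where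
  smooth : SmoothFormOn U η
  ne_zero : ∀ x ∈ U, η x ≠ 0
  local_form : ∀ x ∈ U, ∃ O : TopologicalSpace.Opens M, x ∈ O ∧ O ≤ U ∧
    ∃ (h : M → ℝ) (a : Fin q → ∀ y : M, Module.Dual ℝ (TangentSpace (𝓡 m) y)),
      ContMDiffOn (𝓡 m) 𝓘(ℝ, ℝ) ∞ h (O : Set M) ∧
      (∀ i, SmoothOneFormOn O (a i)) ∧
      ∀ y ∈ O, η y = h y • wedgeCovectors (fun i => a i y) ∧
        Submodule.span ℝ (Set.range fun i => a i y) = (F.tangentSpace y).dualAnnihilator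

end RegularFoliation

end Fol

end

noncomputable section

namespace Fol

/-! The equation `ω₁ = ω₂ ∧ θ` is affine in `θ`, so local solutions can be averaged by a partition
of unity (`exists_smoothFormOn_of_local`). Locally, choose vector fields `X` with `ω₂(X) ≠ 0` and
take for `θ` the contraction of `ω₁` with `X`, divided by `ω₂(X)`. It is smooth because `ω₁` and
`ω₂` are. That it solves the equation is linear algebra at each point (`eq_wedge_contract`). Nesting
puts the tangent spaces of `F_U` inside those of `F_V` (`NestedIn.tangentSpace_le`), so by duality
the factors `b` of `ω₂` lie in the span of the factors of `ω₁`. Complete `b` to a basis of that span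
by covectors `c` that vanish on `X`. Then `ω₁` is a multiple of `b ∧ c`, and contracting `b ∧ c`
with `X` leaves `b(X) • c`. -/

lemma append_update_right {k l : ℕ} [DecidableEq (Fin l)] {α : Type*} (e : Fin k → α)
    (v : Fin l → α) (i : Fin l) (x : α) : Fin.append e (Function.update v i x)
      = Function.update (Fin.append e v) (Fin.natAdd k i) x := by
  ext j
  refine Fin.addCases (fun j => ?_) (fun j => ?_) j
  · have h : Fin.castAdd l j ≠ Fin.natAdd k i := fun h => by
      have := congrArg Fin.val h
      simp at this
      omega
    simp [h]
  · by_cases h : j = i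
    · subst h
      simp
    · simp [h]

/-! ### Exterior algebra of covectors -/

section Linear

variable {E : Type*} [AddCommGroup E] [Module ℝ E] {k l : ℕ}

lemma wedgeCovectors_apply {q : ℕ} (a : Fin q → Module.Dual ℝ E) (v : Fin q → E) :
    wedgeCovectors a v = (Matrix.of fun i j => a j (v i)).det := rfl

/-- A change of covectors multiplies their exterior product by the determinant. -/
lemma wedgeCovectors_sum_smul {q : ℕ} (A : Matrix (Fin q) (Fin q) ℝ)
    (d : Fin q → Module.Dual ℝ E) :
    wedgeCovectors (fun i => ∑ j, A i j • d j) = A.det • wedgeCovectors d := by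
  ext v
  have h : (Matrix.of fun i j => (∑ t, A j t • d t) (v i))
      = (Matrix.of fun i j => d j (v i)) * A.transpose := by
    ext i j
    simp [Matrix.mul_apply, mul_comm]
  rw [wedgeCovectors_apply, h, Matrix.det_mul, Matrix.det_transpose, AlternatingMap.smul_apply,
    wedgeCovectors_apply, smul_eq_mul, mul_comm]

lemma linearIndependent_of_wedgeCovectors_ne_zero {q : ℕ} {a : Fin q → Module.Dual ℝ E}
    (h : wedgeCovectors a ≠ 0) : LinearIndependent ℝ a := by
  obtain ⟨v, hv⟩ : ∃ v, wedgeCovectors a v ≠ 0 := by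
    by_contra! H
    exact h (AlternatingMap.ext H)
  rw [wedgeCovectors_apply] at hv
  let f : Module.Dual ℝ E →ₗ[ℝ] (Fin q → ℝ) := LinearMap.pi fun i => LinearMap.applyₗ (v i)
  exact LinearIndependent.of_comp f (Matrix.linearIndependent_cols_of_det_ne_zero hv)

lemma wedge_add_right (a : E [⋀^Fin k]→ₗ[ℝ] ℝ) (b c : E [⋀^Fin l]→ₗ[ℝ] ℝ) :
    wedge a (b + c) = wedge a b + wedge a c := by
  unfold wedge
  rw [← AlternatingMap.domCoprod'_apply, TensorProduct.tmul_add, map_add,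
    AlternatingMap.domCoprod'_apply, AlternatingMap.domCoprod'_apply]
  ext v
  simp

lemma wedge_smul_right (s : ℝ) (a : E [⋀^Fin k]→ₗ[ℝ] ℝ) (b : E [⋀^Fin l]→ₗ[ℝ] ℝ) :
    wedge a (s • b) = s • wedge a b := by
  unfold wedge
  rw [← AlternatingMap.domCoprod'_apply, TensorProduct.tmul_smul, map_smul,
    AlternatingMap.domCoprod'_apply]
  ext v
  simp

lemma wedge_smul_left (s : ℝ) (a : E [⋀^Fin k]→ₗ[ℝ] ℝ) (b : E [⋀^Fin l]→ₗ[ℝ] ℝ) :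
    wedge (s • a) b = s • wedge a b := by
  unfold wedge
  rw [← AlternatingMap.domCoprod'_apply, ← TensorProduct.smul_tmul', map_smul,
    AlternatingMap.domCoprod'_apply]
  ext v
  simp

lemma convex_setOf_eq_wedge (a : E [⋀^Fin (k + l)]→ₗ[ℝ] ℝ) (b : E [⋀^Fin k]→ₗ[ℝ] ℝ) :
    Convex ℝ {t | a = wedge b t} := by
  intro t ht u hu r s _ _ hrs
  simp only [Set.mem_ofPred_eq] at ht hu ⊢
  rw [wedge_add_right, wedge_smul_right, wedge_smul_right, ← ht, ← hu, ← add_smul, hrs, one_smul]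

/-- This is the Leibniz formula. It lets Mathlib's rule for `domCoprod` of alternatizations compute
`wedge`. -/
lemma wedgeCovectors_eq_alternatization {q : ℕ} (a : Fin q → Module.Dual ℝ E) :
    wedgeCovectors a = MultilinearMap.alternatization
      ((MultilinearMap.mkPiAlgebra ℝ (Fin q) ℝ).compLinearMap a) := by
  ext v
  rw [wedgeCovectors_apply, Matrix.det_apply, MultilinearMap.alternatization_apply]
  rfl

lemma wedge_wedgeCovectors (b : Fin k → Module.Dual ℝ E) (c : Fin l → Module.Dual ℝ E) :
    wedge (wedgeCovectors b) (wedgeCovectors c) = wedgeCovectors (Fin.append b c) := by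
  unfold wedge
  rw [wedgeCovectors_eq_alternatization, wedgeCovectors_eq_alternatization,
    ← MultilinearMap.domCoprod_alternization, wedgeCovectors_eq_alternatization]
  ext v
  simp only [AlternatingMap.domDomCongr_apply, LinearMap.compAlternatingMap_apply,
    MultilinearMap.alternatization_apply, map_sum]
  -- Match permutations of `Fin k ⊕ Fin l` with those of `Fin (k + l)`; signs agree.
  refine Fintype.sum_equiv finSumFinEquiv.permCongr _ _ fun σ => ?_
  rw [Equiv.Perm.sign_permCongr]
  simp only [Units.smul_def, map_zsmul]
  congr 1
  simp [MultilinearMap.domDomCongr_apply, MultilinearMap.domCoprod_apply, Fin.prod_univ_add]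

/-- The contraction `(v₁, …, v_l) ↦ a(e₁, …, e_k, v₁, …, v_l)`. -/
def contract (a : E [⋀^Fin (k + l)]→ₗ[ℝ] ℝ) (e : Fin k → E) : E [⋀^Fin l]→ₗ[ℝ] ℝ where
  toFun v := a (Fin.append e v)
  map_update_add' v i x y := by
    rw [append_update_right, append_update_right, append_update_right, a.map_update_add]
  map_update_smul' v i r x := by
    rw [append_update_right, append_update_right, a.map_update_smul]
  map_eq_zero_of_eq' v i j hv hij := by
    refine a.map_eq_zero_of_eq _ (i := Fin.natAdd k i) (j := Fin.natAdd k j) (by simpa using hv) ?_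
    simpa using hij

lemma contract_apply (a : E [⋀^Fin (k + l)]→ₗ[ℝ] ℝ) (e : Fin k → E) (v : Fin l → E) :
    contract a e v = a (Fin.append e v) := rfl

/-- The determinant is block triangular: rows are vectors, and the block of the `c i (e j)`
vanishes. -/
lemma contract_wedgeCovectors_append (b : Fin k → Module.Dual ℝ E) (c : Fin l → Module.Dual ℝ E)
    (e : Fin k → E) (hc : ∀ i j, c i (e j) = 0) :
    contract (wedgeCovectors (Fin.append b c)) e = wedgeCovectors b e • wedgeCovectors c := by
  ext v
  rw [contract_apply, AlternatingMap.smul_apply]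
  simp only [wedgeCovectors_apply]
  rw [← Matrix.det_submatrix_equiv_self finSumFinEquiv, smul_eq_mul,
    ← Matrix.det_fromBlocks_zero₁₂ _ (Matrix.of fun i j => b j (v i))]
  congr 1
  ext (i | i) (j | j) <;> simp [hc]

/-- If the span of the independent vectors `a₁, …, a_{k+l}` contains `b₁, …, b_k` and `f` maps the
`bᵢ` to a basis of `ℝ^k`, then the `aᵢ` are combinations of the `bᵢ` and of `l` vectors in the
kernel of `f`. -/
lemma exists_adapted_vectors {D : Type*} [AddCommGroup D] [Module ℝ D] {a : Fin (k + l) → D}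
    {b : Fin k → D} (f : D →ₗ[ℝ] (Fin k → ℝ)) (ha : LinearIndependent ℝ a)
    (hb : ∀ i, b i ∈ Submodule.span ℝ (Set.range a))
    (hf : (Matrix.of fun i j => f (b j) i).det ≠ 0) :
    ∃ (c : Fin l → D) (A : Matrix (Fin (k + l)) (Fin (k + l)) ℝ),
      (∀ i, f (c i) = 0) ∧ ∀ i, a i = ∑ j, A i j • Fin.append b c j := by
  set W := Submodule.span ℝ (Set.range a)
  have : FiniteDimensional ℝ W := FiniteDimensional.span_of_finite ℝ (Set.finite_range a)
  have hW : Module.finrank ℝ W = k + l := by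
    rw [finrank_span_eq_card ha, Fintype.card_fin]
  let b' : Fin k → W := fun i => ⟨b i, hb i⟩
  let fW : W →ₗ[ℝ] (Fin k → ℝ) := f.comp W.subtype
  let B : Matrix (Fin k) (Fin k) ℝ := Matrix.of fun i j => f (b j) i
  have hB : IsUnit B.det := isUnit_iff_ne_zero.2 hf
  have hcomb (w : Fin k → ℝ) : fW (∑ j, (B⁻¹.mulVec w) j • b' j) = w := by
    have : fW (∑ j, (B⁻¹.mulVec w) j • b' j) = B.mulVec (B⁻¹.mulVec w) := by
      ext i
      simp [fW, b', B, Matrix.mulVec, dotProduct, mul_comm]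
    rw [this, Matrix.mulVec_mulVec, Matrix.mul_nonsing_inv _ hB, Matrix.one_mulVec]
  -- By `hcomb`, `fW` is onto, so its kernel has dimension `(k + l) - k`.
  have hker : Module.finrank ℝ (LinearMap.ker fW) = l := by
    have h1 := fW.finrank_range_add_finrank_ker
    rw [LinearMap.range_eq_top.2 fun w => ⟨_, hcomb w⟩, finrank_top, hW] at h1
    simp at h1
    omega
  let c := Module.finBasisOfFinrankEq ℝ (LinearMap.ker fW) hker
  -- The projection of `W` onto the kernel along the span of the `b' j`.
  let g : W → LinearMap.ker fW := fun w => ⟨w - ∑ j, (B⁻¹.mulVec (fW w)) j • b' j, by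
    rw [LinearMap.mem_ker, map_sub, hcomb, sub_self]⟩
  let a' : Fin (k + l) → W := fun i => ⟨a i, Submodule.subset_span ⟨i, rfl⟩⟩
  refine ⟨fun j => (c j : W), Matrix.of fun i =>
    Fin.append (B⁻¹.mulVec (fW (a' i))) (c.repr (g (a' i))), fun i => (c i).2, fun i => ?_⟩
  have h1 : (g (a' i) : W) = ∑ j, c.repr (g (a' i)) j • (c j : W) := by
    conv_lhs => rw [← c.sum_repr (g (a' i))]
    rw [Submodule.coe_sum]
    rfl
  have h2 : a' i = ∑ j, (B⁻¹.mulVec (fW (a' i))) j • b' j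
      + ∑ j, c.repr (g (a' i)) j • (c j : W) := by
    rw [← h1]
    simp [g]
  have h3 := congrArg W.subtype h2
  rw [map_add, map_sum, map_sum] at h3
  rw [Fin.sum_univ_add]
  simpa [a', b'] using h3

/-- If `a` and `b` are decomposable and the factors of `a` generate those of `b`, then `a` is the
exterior product of `b` and of a contraction of `a`, divided by the value of `b` on the
contracted vectors. -/
lemma eq_wedge_contract {a : Fin (k + l) → Module.Dual ℝ E} {b : Fin k → Module.Dual ℝ E}
    {e : Fin k → E} (s t : ℝ) (hb : ∀ i, b i ∈ Submodule.span ℝ (Set.range a))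
    (he : (t • wedgeCovectors b) e ≠ 0) :
    s • wedgeCovectors a = wedge (t • wedgeCovectors b)
      (((t • wedgeCovectors b) e)⁻¹ • contract (s • wedgeCovectors a) e) := by
  have hcs (r : ℝ) (u : E [⋀^Fin (k + l)]→ₗ[ℝ] ℝ) : contract (r • u) e = r • contract u e := rfl
  rw [AlternatingMap.smul_apply, smul_eq_mul] at *
  obtain ⟨ht, he⟩ := mul_ne_zero_iff.1 he
  rw [hcs, wedge_smul_left, wedge_smul_right, wedge_smul_right]
  by_cases h : wedgeCovectors a = 0
  · have h0 : contract (0 : E [⋀^Fin (k + l)]→ₗ[ℝ] ℝ) e = (0 : ℝ) • 0 := by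
      rw [zero_smul]; rfl
    rw [h, h0, wedge_smul_right]
    simp
  obtain ⟨c, A, hc, hA⟩ := exists_adapted_vectors (LinearMap.pi fun i => LinearMap.applyₗ (e i))
    (linearIndependent_of_wedgeCovectors_ne_zero h) hb he
  have hAc : wedgeCovectors a = A.det • wedgeCovectors (Fin.append b c) := by
    rw [← wedgeCovectors_sum_smul, ← funext hA]
  rw [hAc, hcs, contract_wedgeCovectors_append b c e fun i j => congrFun (hc i) j, wedge_smul_right, wedge_smul_right,
    wedge_wedgeCovectors]
  simp only [smul_smul]
  congr 1
  field_simp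

end Linear

/-! ### Gluing forms and extending vectors -/

variable {m : ℕ} {M : Type*} [TopologicalSpace M]
  [ChartedSpace (EuclideanSpace ℝ (Fin m)) M] [IsManifold (𝓡 m) ∞ M]

/-- Local smooth forms with values in given convex sets can be glued. -/
lemma exists_smoothFormOn_of_local [T2Space M] [SecondCountableTopology M] {k : ℕ}
    (W : TopologicalSpace.Opens M) (P : ∀ x : M, Set (TangentSpace (𝓡 m) x [⋀^Fin k]→ₗ[ℝ] ℝ))
    (hP : ∀ x ∈ W, Convex ℝ (P x))
    (hloc : ∀ x ∈ W, ∃ O : TopologicalSpace.Opens M, x ∈ O ∧ O ≤ W ∧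
      ∃ η : ∀ x : M, TangentSpace (𝓡 m) x [⋀^Fin k]→ₗ[ℝ] ℝ,
        SmoothFormOn O η ∧ ∀ y ∈ O, η y ∈ P y) :
    ∃ η : ∀ x : M, TangentSpace (𝓡 m) x [⋀^Fin k]→ₗ[ℝ] ℝ,
      SmoothFormOn W η ∧ ∀ y ∈ W, η y ∈ P y := by
  classical
  choose! O hxO hOW η hη hηP using hloc
  have : LocallyCompactSpace W :=
    ChartedSpace.locallyCompactSpace (EuclideanSpace ℝ (Fin m)) W
  let S : W → Set W := fun x => Subtype.val ⁻¹' (O x : Set M)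
  obtain ⟨ρ, hρ⟩ := SmoothPartitionOfUnity.exists_isSubordinate (𝓡 m) (s := (Set.univ : Set W))
    isClosed_univ S (fun x => (O x).isOpen.preimage continuous_subtype_val)
    (fun x _ => Set.mem_iUnion.2 ⟨x, hxO x x.2⟩)
  have hρO (i x : W) (h : ρ i x ≠ 0) : (x : M) ∈ O i :=
    hρ i (subset_tsupport _ h)
  -- The partition of unity lives on the manifold `W`; the extension by zero only serves to define a
  -- form at every point of `M`.
  let r : W → M → ℝ := fun i x => if h : x ∈ W then ρ i ⟨x, h⟩ else 0
  have hr (i x : W) : r i x = ρ i x := dif_pos x.2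
  refine ⟨fun x => ∑ᶠ i : W, r i x • η i x, ?_, ?_⟩
  · intro T hT X hX x hx
    refine ContMDiffAt.contMDiffWithinAt ?_
    lift x to W using hT hx
    rw [← contMDiffAt_subtype_iff]
    have hsum (y : W) : (∑ᶠ i : W, r i y • η i y) (fun j => X j y)
        = ∑ᶠ i : W, ρ i y • η i y (fun j => X j y) := by
      let ev : (TangentSpace (𝓡 m) (y : M) [⋀^Fin k]→ₗ[ℝ] ℝ) →+ ℝ :=
        { toFun := fun f => f (fun j => X j y), map_zero' := rfl, map_add' := fun _ _ => rfl }
      have hfin : (Function.support fun i : W => r i y • η i y).Finite :=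
        (ρ.locallyFinite.point_finite y).subset fun i hi h => hi (by simp [hr, h])
      refine (ev.map_finsum hfin).trans (finsum_congr fun i => ?_)
      rw [hr]
      rfl
    simp only [hsum]
    refine ρ.contMDiffAt_finsum fun i hi => ?_
    have hxi : (x : M) ∈ O i := hρ i hi
    rw [contMDiffAt_subtype_iff (f := fun y : M => η i y (fun j => X j y))]
    exact (hη i i.2 (O i ⊓ T) inf_le_left X
      (fun j => (hX j).mono Set.inter_subset_right)).contMDiffAt
      ((O i ⊓ T).isOpen.mem_nhds ⟨hxi, hx⟩)
  · intro y hy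
    lift y to W using hy
    refine (hP y y.2).finsum_mem (fun i => ?_) ?_ fun i hi => ?_
    · rw [hr]
      exact ρ.nonneg i y
    · simp only [hr]
      exact ρ.sum_eq_one (Set.mem_univ y)
    · rw [hr] at hi
      exact hηP i i.2 y (hρO i y hi)

/-- Near every point, finitely many tangent vectors extend to smooth vector fields. -/
lemma exists_smoothVectorFieldOn_extend {k : ℕ} (x : M) (v : Fin k → TangentSpace (𝓡 m) x) :
    ∃ O : TopologicalSpace.Opens M, x ∈ O ∧ ∃ X : Fin k → ∀ y : M, TangentSpace (𝓡 m) y,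
      (∀ i, SmoothVectorFieldOn (O : Set M) (X i)) ∧ ∀ i, X i x = v i := by
  have h (i : Fin k) := FiberBundle.exists_contMDiffOn_extend (k := ∞) (𝓡 m)
    (EuclideanSpace ℝ (Fin m)) (v i)
  choose s hs hsm using h
  obtain ⟨O, hO, hOo, hxO⟩ := mem_nhds_iff.1 (Filter.iInter_mem.2 hs)
  exact ⟨⟨O, hOo⟩, hxO, fun i => FiberBundle.extend (EuclideanSpace ℝ (Fin m)) (v i),
    fun i => (hsm i).mono (hO.trans (Set.iInter_subset s i)), fun i => by simp⟩

/-! ### Tangent spaces of nested foliations -/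

namespace RegularFoliation

variable {U V : TopologicalSpace.Opens M} {q q' : ℕ}

lemma NestedIn.tangentSpace_le {F : RegularFoliation m U q} {G : RegularFoliation m V q'}
    (h : F.NestedIn G) {x : M} (hx : x ∈ U ⊓ V) : F.tangentSpace x ≤ G.tangentSpace x := by
  intro v hv φ hφ hxφ i hi
  -- The slice of `φ` through `x` is leaf-open for `G`, hence for `F`: near `x` it contains a slice
  -- of some chart `ψ` of `F`.
  let P : Set M := {y | y ∈ φ.source ∩ (U ⊓ V : TopologicalSpace.Opens M) ∧ SameSlice q' φ x y}
  have hP : G.IsLeafOpen P := by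
    refine ⟨fun y hy => hy.1.2.2, fun y hy => ⟨φ, hφ, hy.1.1, (U ⊓ V : TopologicalSpace.Opens M),
      (U ⊓ V).isOpen, hy.1.2, fun z hz hyz => ⟨⟨hz.2, hz.1⟩, fun j hj => ?_⟩⟩⟩
    exact (hy.2 j hj).trans (hyz j hj)
  obtain ⟨ψ, hψ, hxψ, O, hO, hxO, hOP⟩ := (h P (fun y hy => hy.1.2) hP).2 x
    ⟨⟨hxφ, hx⟩, fun _ _ => rfl⟩
  set w : EuclideanSpace ℝ (Fin m) :=
    mfderiv (𝓡 m) 𝓘(ℝ, EuclideanSpace ℝ (Fin m)) ψ x v with hw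
  have hwi : ∀ j : Fin m, m ≤ (j : ℕ) + q → w j = 0 := hv ψ hψ hxψ
  let T : EuclideanSpace ℝ (Fin m) → EuclideanSpace ℝ (Fin m) := φ ∘ ψ.symm
  have hψx : ψ.symm (ψ x) = x := ψ.left_inv hxψ
  have hdψ : MDifferentiableAt (𝓡 m) 𝓘(ℝ, EuclideanSpace ℝ (Fin m)) ψ x :=
    (contMDiffAt_of_mem_maximalAtlas (F.smooth hψ) hxψ).mdifferentiableAt (by simp)
  have hdφ : MDifferentiableAt (𝓡 m) 𝓘(ℝ, EuclideanSpace ℝ (Fin m)) φ (ψ.symm (ψ x)) := by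
    rw [hψx]
    exact (contMDiffAt_of_mem_maximalAtlas (G.smooth hφ) hxφ).mdifferentiableAt (by simp)
  have hdT : MDifferentiableAt 𝓘(ℝ, EuclideanSpace ℝ (Fin m))
      𝓘(ℝ, EuclideanSpace ℝ (Fin m)) T (ψ x) :=
    hdφ.comp (ψ x) ((contMDiffAt_symm_of_mem_maximalAtlas (F.smooth hψ)
      (ψ.map_source hxψ)).mdifferentiableAt (by simp))
  have hcomp : mfderiv (𝓡 m) 𝓘(ℝ, EuclideanSpace ℝ (Fin m)) φ x v = fderiv ℝ T (ψ x) w := by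
    have hev : φ =ᶠ[𝓝 x] T ∘ ψ := by
      filter_upwards [ψ.open_source.mem_nhds hxψ] with y hy
      simp [T, ψ.left_inv hy]
    rw [hev.mfderiv_eq, mfderiv_comp x hdT hdψ, mfderiv_eq_fderiv]
    rfl
  -- This line stays in the `ψ`-slice of `x`, since the last `q` components of `w` vanish. So the
  -- `i`-th coordinate of `φ` is constant along it near `t = 0`, and its derivative there, the
  -- `i`-th component of `dφ(v)`, is zero.
  let γ : ℝ → EuclideanSpace ℝ (Fin m) := fun t => ψ x + t • w
  have hγ0 : γ 0 = ψ x := by simp [γ]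
  have hγ : HasDerivAt γ w 0 := by
    have h1 := ((hasDerivAt_id (0 : ℝ)).smul_const w).const_add (ψ x)
    rwa [one_smul] at h1
  have hderiv : HasDerivAt (fun t => T (γ t) i) (fderiv ℝ T (ψ x) w i) 0 := by
    have h1 : HasFDerivAt T (fderiv ℝ T (ψ x)) (γ 0) := by
      rw [hγ0]
      exact hdT.differentiableAt.hasFDerivAt
    have h2 := h1.comp_hasDerivAt (0 : ℝ) hγ
    exact (EuclideanSpace.proj (𝕜 := ℝ) i).hasFDerivAt.comp_hasDerivAt
      (0 : ℝ) h2
  have hconst : (fun t => T (γ t) i) =ᶠ[𝓝 0] fun _ => φ x i := by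
    have hcont : Filter.Tendsto γ (𝓝 0) (𝓝 (ψ x)) := hγ0 ▸ hγ.continuousAt.tendsto
    have hsymm : Filter.Tendsto (fun t => ψ.symm (γ t)) (𝓝 0) (𝓝 x) := by
      have := (ψ.continuousAt_symm (ψ.map_source hxψ)).tendsto.comp hcont
      rwa [hψx] at this
    filter_upwards [hcont (ψ.open_target.mem_nhds (ψ.map_source hxψ)),
      hsymm (hO.mem_nhds hxO)] with t ht htO
    refine ((hOP (ψ.symm (γ t)) ⟨htO, ψ.map_target ht⟩ fun j hj => ?_).2 i hi).symm
    rw [ψ.right_inv ht]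
    simp [γ, hwi j hj]
  have := hderiv.unique ((hasDerivAt_const (0 : ℝ) (φ x i)).congr_of_eventuallyEq hconst)
  rw [← this, ← hcomp]

end RegularFoliation

/-! ### Smoothness of the local solution, and the theorem -/

lemma SmoothFormOn.mono {W W' : TopologicalSpace.Opens M} {k : ℕ}
    {η : ∀ x : M, TangentSpace (𝓡 m) x [⋀^Fin k]→ₗ[ℝ] ℝ} (h : SmoothFormOn W η) (hW : W' ≤ W) :
    SmoothFormOn W' η := fun O hO => h O (hO.trans hW)

/-- The quotient of a contraction by a non-vanishing evaluation is smooth. -/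
lemma SmoothFormOn.inv_smul_contract {W O : TopologicalSpace.Opens M} {k l : ℕ}
    {α : ∀ x : M, TangentSpace (𝓡 m) x [⋀^Fin (k + l)]→ₗ[ℝ] ℝ}
    {β : ∀ x : M, TangentSpace (𝓡 m) x [⋀^Fin k]→ₗ[ℝ] ℝ} (hα : SmoothFormOn W α)
    (hβ : SmoothFormOn W β) (hO : O ≤ W) {X : Fin k → ∀ y : M, TangentSpace (𝓡 m) y}
    (hX : ∀ i, SmoothVectorFieldOn (O : Set M) (X i)) (h0 : ∀ y ∈ O, β y (fun i => X i y) ≠ 0) :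
    SmoothFormOn O fun y => (β y (fun i => X i y))⁻¹ • contract (α y) (fun i => X i y) := by
  intro O' hO' Y hY
  have hX' (i : Fin k) : SmoothVectorFieldOn (O' : Set M) (X i) := (hX i).mono hO'
  have h1 := hβ O' (hO'.trans hO) X hX'
  have h2 := hα O' (hO'.trans hO) (Fin.append X Y) fun i =>
    Fin.addCases (fun i => by simpa using hX' i) (fun i => by simpa using hY i) i
  refine ((h1.inv₀ fun y hy => h0 y (hO' hy)).mul h2).congr fun y _ => ?_
  rw [AlternatingMap.smul_apply, contract_apply, smul_eq_mul]
  congr 2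
  ext i
  refine Fin.addCases (fun i => ?_) (fun i => ?_) i <;> simp

end Fol
end

theorem proposition4p1 {m : ℕ} {M : Type*} [TopologicalSpace M] [T2Space M]
    [SecondCountableTopology M] [ChartedSpace (EuclideanSpace ℝ (Fin m)) M]
    [IsManifold (𝓡 m) ∞ M] (U V : TopologicalSpace.Opens M) (q₁ q₂ : ℕ) (hq₁ : 0 < q₁)
    (F_U : Fol.RegularFoliation m U (q₂ + q₁)) (F_V : Fol.RegularFoliation m V q₂)
    (hUV : F_U.NestedIn F_V)
    (ω₁ : ∀ x : M, TangentSpace (𝓡 m) x [⋀^Fin (q₂ + q₁)]→ₗ[ℝ] ℝ)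
    (ω₂ : ∀ x : M, TangentSpace (𝓡 m) x [⋀^Fin q₂]→ₗ[ℝ] ℝ)
    (hω₁ : F_U.DefinedBy ω₁) (hω₂ : F_V.DefinedBy ω₂) :
    ∃ θ : ∀ x : M, TangentSpace (𝓡 m) x [⋀^Fin q₁]→ₗ[ℝ] ℝ,
      Fol.SmoothFormOn (U ⊓ V) θ ∧ ∀ x ∈ U ⊓ V, ω₁ x = Fol.wedge (ω₂ x) (θ x) := by
  refine Fol.exists_smoothFormOn_of_local (U ⊓ V) (fun x => {t | ω₁ x = Fol.wedge (ω₂ x) t})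
    (fun x _ => Fol.convex_setOf_eq_wedge _ _) fun x hx => ?_
  obtain ⟨e, he⟩ : ∃ e, ω₂ x e ≠ 0 := by
    by_contra! H
    exact hω₂.ne_zero x hx.2 (AlternatingMap.ext H)
  obtain ⟨N, hxN, X, hX, hXx⟩ := Fol.exists_smoothVectorFieldOn_extend x e
  have hcont : ContinuousOn (fun y => ω₂ y (fun i => X i y)) (N ⊓ V : TopologicalSpace.Opens M) :=
    (hω₂.smooth (N ⊓ V) inf_le_right X
      fun i => (hX i).mono Set.inter_subset_left).continuousOn
  -- The part of `N ⊓ U ⊓ V` where `ω₂(X)` is nonzero, open by continuity.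
  let O : TopologicalSpace.Opens M :=
    ⟨_, (hcont.isOpen_inter_preimage (N ⊓ V).isOpen isOpen_ne (t := {s : ℝ | s ≠ 0})).inter
      (U ⊓ V).isOpen⟩
  have hOW : O ≤ U ⊓ V := fun y hy => hy.2
  refine ⟨O, ⟨⟨⟨hxN, hx.2⟩, ?_⟩, hx⟩, hOW, _,
    (hω₁.smooth.mono inf_le_left).inv_smul_contract (hω₂.smooth.mono inf_le_right) hOW
      (fun i => (hX i).mono fun y hy => hy.1.1.1) fun y hy => hy.1.2, fun y hy => ?_⟩
  · simpa [hXx] using he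
  · obtain ⟨O₁, hy₁, -, h₁, a, -, -, ha⟩ := hω₁.local_form y hy.2.1
    obtain ⟨O₂, hy₂, -, h₂, b, -, -, hb⟩ := hω₂.local_form y hy.2.2
    obtain ⟨ha₁, ha₂⟩ := ha y hy₁
    obtain ⟨hb₁, hb₂⟩ := hb y hy₂
    have hne : ω₂ y (fun i => X i y) ≠ 0 := hy.1.2
    simp only [Set.mem_ofPred_eq]
    rw [hb₁] at hne ⊢
    rw [ha₁]
    refine Fol.eq_wedge_contract _ _ (fun i => ?_) hne
    rw [ha₂]
    -- Covectors vanishing on the larger tangent space of `F_V` vanish on that of `F_U`.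
    refine Submodule.dualAnnihilator_anti (hUV.tangentSpace_le hy.2) ?_
    rw [← hb₂]
    exact Submodule.subset_span ⟨i, rfl⟩
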